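/- Let $\mathbb{T}_1$ and $\mathbb{T}_2$ be single-sorted equational theories over disjoint signatures $\Sigma_1$ and $\Sigma_2$ of operation symbols. A function symbol $f$ of arity $m \geq 1$ is a \emph{projection} in a theory $\mathbb{T}$ if $\mathbb{T} \vdash f(y_1, \ldots, y_m) = y_i$ for some $i$, and it is \emph{constant} in $\mathbb{T}$ if $\mathbb{T} \vdash f(y_1, \ldots, y_m) = s$ for some (not necessarily closed) term $s$ in which none of $y_1, \ldots, y_m$ occurs, where $y_1, \ldots, y_m$ are pairwise distinct variables. Suppose that for each $i \in \{1, 2\}$ the signature $\Sigma_i$ contains a function symbol of arity at least $1$ that is neither constant nor a projection in $\mathbb{T}_i$. Let $\mathbb{T}_1 + \mathbb{T}_2$ be the theory over $\Sigma_1 \cup \Sigma_2$ whose axioms are those of $\mathbb{T}_1$ together with those of $\mathbb{T}_2$. For an equational theory $\mathbb{T}$ over a signature $\Sigma$ and pairwise distinct new constant symbols $c_1, \ldots, c_k$, let $\Sigma(c_1, \ldots, c_k)$ be $\Sigma$ with these constants added, and let $\mathbb{T}(c_1, \ldots, c_k)$ be the theory with the same axioms as $\mathbb{T}$, regarded as a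 theory over $\Sigma(c_1, \ldots, c_k)$. Let $M_n$ be the free $\mathbb{T}$-model on $n$ generators, i.e. the set of closed terms over $\Sigma(\mathsf{y}_1, \ldots, \mathsf{y}_n)$ modulo provable equality in $\mathbb{T}(\mathsf{y}_1, \ldots, \mathsf{y}_n)$. The \emph{logical isotropy group} $G_{\mathbb{T}}(M_n)$ is the set of all classes $[t]$, modulo provable equality in $\mathbb{T}(\mathsf{x}, \mathsf{y}_1, \ldots, \mathsf{y}_n)$, of closed terms $t$ over $\Sigma(\mathsf{x}, \mathsf{y}_1, \ldots, \mathsf{y}_n)$ such that (i) $t$ is invertible: there is a closed term $t^{-1}$ over $\Sigma(\mathsf{x}, \mathsf{y}_1, \ldots, \mathsf{y}_n)$ with $\mathbb{T}(\mathsf{x}, \mathsf{y}_1, \ldots, \mathsf{y}_n) \vdash t[t^{-1}/\mathsf{x}] = \mathsf{x} = t^{-1}[t/\mathsf{x}]$; and (ii) $t$ commutes generically with all function symbols of $\Sigma$: for every $m \geq 0$ and every $m$-ary function symbol $f$ of $\Sigma$, $$\mathbb{T}(\mathsf{x}_1, \ldots, \mathsf{x}_m, \mathsf{y}_1, \ldots,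 \mathsf{y}_n) \vdash t[f(\mathsf{x}_1, \ldots, \mathsf{x}_m)/\mathsf{x}] = f(t[\mathsf{x}_1/\mathsf{x}], \ldots, t[\mathsf{x}_m/\mathsf{x}]).$$ Then for every $n \geq 0$, $$G_{\mathbb{T}_1 + \mathbb{T}_2}(M_n) = \{ [\mathsf{x}] \},$$ where $M_n$ is the free $(\mathbb{T}_1 + \mathbb{T}_2)$-model on $n$ generators; that is, the logical isotropy group of $M_n$ is trivial. -/

import Mathlib

open scoped FirstOrder

universe u₁ v₁ u₂ v₂ u v w w'

namespace EqLogic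

open FirstOrder.Language

/-- A single-sorted equational theory over the signature `L`: a set of equations (pairs of terms)
over the countably infinite set of variables `ℕ`. -/
abbrev EqTheory (L : FirstOrder.Language.{u, v}) := Set (L.Term ℕ × L.Term ℕ)

/-- `Proves T s t`: the theory `T` proves the equation `s = t` in equational logic. -/
inductive Proves {L : FirstOrder.Language.{u, v}} (T : EqTheory L) : L.Term ℕ → L.Term ℕ → Prop
  /-- every substitution instance of an axiom is provable -/
  | ax (a b : L.Term ℕ) (h : (a, b) ∈ T) (σ : ℕ → L.Term ℕ) : Proves T (a.subst σ) (b.subst σ)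
  | refl (s : L.Term ℕ) : Proves T s s
  | symm {s t : L.Term ℕ} : Proves T s t → Proves T t s
  | trans {s t r : L.Term ℕ} : Proves T s t → Proves T t r → Proves T s r
  /-- compatibility with function symbols -/
  | congr {m : ℕ} (f : L.Functions m) (s t : Fin m → L.Term ℕ) :
      (∀ i, Proves T (s i) (t i)) → Proves T (Term.func f s) (Term.func f t)

/-- The translation of an equational theory along a map of signatures. -/
def EqTheory.map {L : FirstOrder.Language.{u, v}} {L' : FirstOrder.Language.{u₁, v₁}} (φ : L →ᴸ L') (T : EqTheory L) :
    EqTheory L' :=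
  (fun e => (φ.onTerm e.1, φ.onTerm e.2)) '' T

/-- The disjoint union `T₁ + T₂` of two equational theories: the signature is the disjoint union
of the two signatures and the axioms are all axioms of `T₁` and all axioms of `T₂`. -/
def EqTheory.disjUnion {L₁ : FirstOrder.Language.{u₁, v₁}} {L₂ : FirstOrder.Language.{u₂, v₂}}
    (T₁ : EqTheory L₁) (T₂ : EqTheory L₂) : EqTheory (L₁.sum L₂) :=
  T₁.map LHom.sumInl ∪ T₂.map LHom.sumInr

/-- The term `f(y₁, …, yₘ)` with pairwise distinct variables `y₁, …, yₘ`. -/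
def genericTerm {L : FirstOrder.Language.{u, v}} {m : ℕ} (f : L.Functions m) : L.Term ℕ :=
  Term.func f fun i => Term.var (i : ℕ)

/-- `f` is a projection in `T`: `T` proves `f(y₁, …, yₘ) = yᵢ` for some `i`. -/
def IsProjection {L : FirstOrder.Language.{u, v}} (T : EqTheory L) {m : ℕ} (f : L.Functions m) : Prop :=
  ∃ i : Fin m, Proves T (genericTerm f) (Term.var (i : ℕ))

/-- `f` is constant in `T`: `T` proves `f(y₁, …, yₘ) = s` for some (not necessarily closed) term
`s` in which none of the variables `y₁, …, yₘ` occurs. -/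
def IsConstant {L : FirstOrder.Language.{u, v}} (T : EqTheory L) {m : ℕ} (f : L.Functions m) : Prop :=
  ∃ s : L.Term ℕ, (∀ i : Fin m, (i : ℕ) ∉ s.varFinset) ∧ Proves T (genericTerm f) s

/-- Closed terms over the signature `L(γ)`, i.e. `L` with the elements of `γ` added as new,
pairwise distinct constant symbols. -/
abbrev ClosedTerm (L : FirstOrder.Language.{u, v}) (γ : Type w) := L[[γ]].Term Empty

/-- The new constant symbol `c`, as a closed term. -/
def const {L : FirstOrder.Language.{u, v}} {γ : Type w} (c : γ) : ClosedTerm L γ :=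
  (L.con c).term

/-- The closed term `f(s₁, …, sₘ)` for a function symbol `f` of `L`. -/
def app {L : FirstOrder.Language.{u, v}} {γ : Type w} {m : ℕ} (f : L.Functions m)
    (s : Fin m → ClosedTerm L γ) : ClosedTerm L γ :=
  Term.func (L := L[[γ]]) (Sum.inl f) s

/-- Simultaneous substitution of closed terms `σ c` for the added constants `c`. -/
def substConst {L : FirstOrder.Language.{u, v}} {γ : Type w} {δ : Type w'} (σ : γ → ClosedTerm L δ) :
    ClosedTerm L γ → ClosedTerm L δ
  | Term.var a => a.elim
  | @Term.func _ _ _ (Sum.inl f) s => app f fun i => substConst σ (s i)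
  | @Term.func _ _ 0 (Sum.inr c) _ => σ c
  | @Term.func _ _ (_ + 1) (Sum.inr c) _ => isEmptyElim c

/-- `T(γ) ⊢ s = t` for closed terms `s`, `t` over `L(γ)`, where `T(γ)` is the theory with the
same axioms as `T`, but regarded as a theory over the signature `L(γ)`. -/
def ProvesClosed {L : FirstOrder.Language.{u, v}} (T : EqTheory L) (γ : Type w) (s t : ClosedTerm L γ) :
    Prop :=
  Proves (T.map (L.lhomWithConstants γ)) (s.relabel Empty.elim) (t.relabel Empty.elim)

/-- Provable equality as an equivalence relation on the closed terms over `L(γ)`. -/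
def closedSetoid {L : FirstOrder.Language.{u, v}} (T : EqTheory L) (γ : Type w) :
    Setoid (ClosedTerm L γ) where
  r := ProvesClosed T γ
  iseqv := ⟨fun _ => Proves.refl _, Proves.symm, Proves.trans⟩

/-- The set of closed terms over `L(γ)` modulo provable equality in `T(γ)`; this is the underlying
set of the free `T`-model generated by `γ` (in particular, of the free model `Mₙ` on `n` generators
for `γ = Fin n`). -/
def FreeModel {L : FirstOrder.Language.{u, v}} (T : EqTheory L) (γ : Type w) :=
  Quotient (closedSetoid T γ)

/-- The class `[t]` of a closed term `t`. -/
def cls {L : FirstOrder.Language.{u, v}} (T : EqTheory L) {γ : Type w} (t : ClosedTerm L γ) :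
    FreeModel T γ :=
  Quotient.mk (closedSetoid T γ) t

/-- The constants `x, y₁, …, yₙ`. -/
abbrev XY (n : ℕ) := Unit ⊕ Fin n

/-- The constant `x`, as a closed term over `L(x, y₁, …, yₙ)`. -/
def xTerm (L : FirstOrder.Language.{u, v}) (n : ℕ) : ClosedTerm L (XY n) := const (Sum.inl ())

/-- `t[s/x]`, where `t` is a closed term over `L(x, y₁, …, yₙ)` and `s` is a closed term over
`L(γ, y₁, …, yₙ)`. -/
def substX {L : FirstOrder.Language.{u, v}} {n : ℕ} {γ : Type w} (t : ClosedTerm L (XY n))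
    (s : ClosedTerm L (γ ⊕ Fin n)) : ClosedTerm L (γ ⊕ Fin n) :=
  substConst (Sum.elim (fun _ => s) fun j => const (Sum.inr j)) t

/-- `t` is invertible: there is a closed term `t'` over `L(x, y₁, …, yₙ)` with
`T(x, y₁, …, yₙ) ⊢ t[t'/x] = x = t'[t/x]`. -/
def Invertible {L : FirstOrder.Language.{u, v}} (T : EqTheory L) {n : ℕ} (t : ClosedTerm L (XY n)) : Prop :=
  ∃ t' : ClosedTerm L (XY n),
    ProvesClosed T (XY n) (substX t t') (xTerm L n) ∧
    ProvesClosed T (XY n) (xTerm L n) (substX t' t)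

/-- `t` commutes generically with the function symbol `f` of arity `m`:
`T(x₁, …, xₘ, y₁, …, yₙ) ⊢ t[f(x₁, …, xₘ)/x] = f(t[x₁/x], …, t[xₘ/x])`. -/
def CommutesWith {L : FirstOrder.Language.{u, v}} (T : EqTheory L) {n : ℕ} (t : ClosedTerm L (XY n))
    {m : ℕ} (f : L.Functions m) : Prop :=
  ProvesClosed T (Fin m ⊕ Fin n)
    (substX t (app f fun i => const (Sum.inl i)))
    (app f fun i => substX t (const (Sum.inl i)))

/-- The logical isotropy group `G_T(Mₙ)` of the free `T`-model on `n` generators: the set of all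
classes `[t]` of closed terms over `L(x, y₁, …, yₙ)` that are invertible and commute generically
with all function symbols of `L`. -/
def isotropyGroup {L : FirstOrder.Language.{u, v}} (T : EqTheory L) (n : ℕ) : Set (FreeModel T (XY n)) :=
  {q | ∃ t : ClosedTerm L (XY n), cls T t = q ∧ Invertible T t ∧
    ∀ (m : ℕ) (f : L.Functions m), CommutesWith T t f}

end EqLogic

/-!
A model of `T₁ + T₂` is a set carrying a `T₁`-structure and a `T₂`-structure with no relation
between them, and a closed term `t` over `L(x, y₁, …, yₙ)` defines an operation `τ` on every such
model with chosen values of the `yⱼ`. If `t` is invertible and commutes generically with all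
function symbols, then `τ` is injective and commutes with all operations; being defined by a term,
it also commutes with every endomorphism fixing the `yⱼ`. It is enough to prove `τ x = x` in one
model that maps to the free model by a homomorphism sending generators to generators.

Such a model `S` is built in `exists_model`. As a `T₁`-model it is freely generated by a subset
`A`, as a `T₂`-model by a subset `B`, every element lies in `A` or in `B`, and `A ∩ B` contains the
generators. These conditions describe `S` as a fixed point: the elements outside `A` are the
non-generators of the free `T₁`-model on `A`, and symmetrically for `B`. The fixed point is found by
the Knaster–Tarski theorem inside a sufficiently large set of codes. Each code carries a label in
the free `(T₁ + T₂)`-model, so the homomorphism from `S` is available without normal forms or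
recursion. Independence is only needed against the term model, which detects provability.

In `S` the number of alternations between the two signatures is well behaved
(`layer_succ_subset_closure`). Suppose `τ x` needs exactly `k + 1` alternations, with an operation
of `T₁` outermost, and let `f` be an operation of `T₂` that is neither constant nor a projection.
Then `f(τ x₁, …, τ xₘ)` needs one more alternation, with `f` outermost (`funMap_notMem_layer`). It
equals `τ (f(x₁, …, xₘ))`, the result of substituting `f(x₁, …, xₘ)` for `x` in `τ x`, which can
be written with `T₁` outermost and at most `k + 2` alternations; a contradiction
(`mem_layer_of_natural`). Hence `τ x` is a generator, and injectivity and naturality leave only `x`.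
-/

namespace EqLogic

open FirstOrder.Language FirstOrder.Language.Structure

/-! ### Models of an equational theory -/

/-- The structure `M` satisfies every equation of the theory `T`. -/
def Models {L : FirstOrder.Language.{u, v}} (T : EqTheory L) (M : Type w) [L.Structure M] : Prop :=
  ∀ e ∈ T, ∀ v : ℕ → M, e.1.realize v = e.2.realize v

/-- `φ` commutes with the operations of `L`. Bundled homomorphisms also preserve relations, which
play no role in equational logic, so a bare predicate on functions is used. -/
def IsHom (L : FirstOrder.Language.{u, v}) {M : Type w} {N : Type w'} [L.Structure M]
    [L.Structure N] (φ : M → N) : Prop :=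
  ∀ (m : ℕ) (f : L.Functions m) (a : Fin m → M), φ (funMap f a) = funMap f fun i => φ (a i)

section Models

variable {L : FirstOrder.Language.{u, v}}

theorem IsHom.comp {M N P : Type*} [L.Structure M] [L.Structure N] [L.Structure P] {ψ : N → P}
    {φ : M → N} (hψ : IsHom L ψ) (hφ : IsHom L φ) : IsHom L (ψ ∘ φ) := by
  intro m f a
  simp only [Function.comp, hφ m f, hψ m f]

theorem IsHom.realize {M N : Type*} [L.Structure M] [L.Structure N] {φ : M → N} (hφ : IsHom L φ)
    {α : Type*} (v : α → M) (t : L.Term α) : φ (t.realize v) = t.realize fun i => φ (v i) := by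
  induction t with
  | var i => rfl
  | func f ts ih => simp only [Term.realize_func, hφ _ f, ih]

theorem IsHom.mem_closure_image {M N : Type*} [L.Structure M] [L.Structure N] {φ : M → N}
    (hφ : IsHom L φ) {s : Set M} {t : Set N} (hst : ∀ a ∈ s, φ a ∈ Substructure.closure L t)
    {a : M} (ha : a ∈ Substructure.closure L s) : φ a ∈ Substructure.closure L t := by
  refine Substructure.closure_induction (p := fun a => φ a ∈ Substructure.closure L t) ha hst ?_
  intro m f x hx
  change φ _ ∈ Substructure.closure L t
  rw [hφ _ f]
  exact (Substructure.closure L t).fun_mem f _ hx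

theorem IsHom.eqOn_closure {M N : Type*} [L.Structure M] [L.Structure N] {φ ψ : M → N}
    (hφ : IsHom L φ) (hψ : IsHom L ψ) {s : Set M} (h : Set.EqOn φ ψ s) {a : M}
    (ha : a ∈ Substructure.closure L s) : φ a = ψ a := by
  refine Substructure.closure_induction (p := fun a => φ a = ψ a) ha h ?_
  intro m f x hx
  change φ _ = ψ _
  rw [hφ _ f, hψ _ f]
  exact congrArg _ (funext hx)

theorem realize_subst {M : Type*} [L.Structure M] {α β : Type*} (t : L.Term α) (σ : α → L.Term β)
    (v : β → M) : (t.subst σ).realize v = t.realize fun i => (σ i).realize v := by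
  induction t with
  | var i => rfl
  | func f ts ih => simp only [Term.subst, Term.realize_func, ih]

theorem Proves.sound {T : EqTheory L} {M : Type*} [L.Structure M] (hM : Models T M)
    {s t : L.Term ℕ} (h : Proves T s t) (v : ℕ → M) : s.realize v = t.realize v := by
  induction h with
  | ax a b hab σ => rw [realize_subst, realize_subst]; exact hM _ hab _
  | refl => rfl
  | symm _ ih => exact ih.symm
  | trans _ _ ih₁ ih₂ => exact ih₁.trans ih₂
  | congr f s t _ ih => simp only [Term.realize_func, ih]

/-- A structure that is mapped to models by a jointly injective family of homomorphisms is a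
model. -/
theorem Models.of_isHom {T : EqTheory L} {M : Type*} [L.Structure M] {ι : Type*} {N : ι → Type*}
    [∀ i, L.Structure (N i)] (hN : ∀ i, Models T (N i)) (φ : ∀ i, M → N i)
    (hφ : ∀ i, IsHom L (φ i)) (hinj : ∀ a b, (∀ i, φ i a = φ i b) → a = b) : Models T M := by
  intro e he v
  refine hinj _ _ fun i => ?_
  rw [(hφ i).realize, (hφ i).realize]
  exact hN i e he _

theorem models_map {L' : FirstOrder.Language.{u₁, v₁}} (φ : L →ᴸ L') (T : EqTheory L) {M : Type*}
    [L.Structure M] [L'.Structure M] [φ.IsExpansionOn M] :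
    Models (T.map φ) M ↔ Models T M := by
  constructor
  · intro h e he v
    have := h _ ⟨e, he, rfl⟩ v
    simpa only [LHom.realize_onTerm] using this
  · rintro h _ ⟨e, he, rfl⟩ v
    simpa only [LHom.realize_onTerm] using h e he v

end Models

/-! ### The term model -/

section TermModel

variable {L : FirstOrder.Language.{u, v}} (T : EqTheory L)

/-- Provable equality of terms over the variables `ℕ`. -/
def termSetoid : Setoid (L.Term ℕ) where
  r := Proves T
  iseqv := ⟨Proves.refl, Proves.symm, Proves.trans⟩

/-- The term model: terms over the variables `ℕ` modulo provable equality, that is, the free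
`T`-model on `ℕ`. It detects which equations are provable in `T`. -/
def TermModel := Quotient (termSetoid T)

/-- The class of a term in the term model. -/
def TermModel.mk (t : L.Term ℕ) : TermModel T := Quotient.mk (termSetoid T) t

variable {T}

theorem TermModel.mk_eq_mk {s t : L.Term ℕ} : TermModel.mk T s = TermModel.mk T t ↔ Proves T s t :=
  Quotient.eq (r := termSetoid T)

theorem TermModel.mk_out (a : TermModel T) : TermModel.mk T (Quotient.out a) = a :=
  Quotient.out_eq a

noncomputable instance : L.Structure (TermModel T) where
  funMap f a := TermModel.mk T (Term.func f fun i => Quotient.out (a i))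
  RelMap _ _ := False

theorem TermModel.funMap_mk {m : ℕ} (f : L.Functions m) (t : Fin m → L.Term ℕ) :
    funMap f (fun i => TermModel.mk T (t i)) = TermModel.mk T (Term.func f t) :=
  mk_eq_mk.2 (Proves.congr f _ _ fun _ => mk_eq_mk.1 (mk_out _))

theorem TermModel.models : Models T (TermModel T) := by
  have key : ∀ (v : ℕ → TermModel T) (t : L.Term ℕ),
      t.realize v = TermModel.mk T (t.subst fun i => Quotient.out (v i)) := by
    intro v t
    induction t with
    | var i => exact (mk_out _).symm
    | func f ts ih => simp only [Term.realize_func, ih, funMap_mk, Term.subst]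
  intro e he v
  rw [key, key]
  exact mk_eq_mk.2 (Proves.ax _ _ he _)

/-- The generators of the term model. -/
def TermModel.gen (T : EqTheory L) (i : ℕ) : TermModel T := TermModel.mk T (Term.var i)

theorem TermModel.nontrivial {m : ℕ} {f : L.Functions m} (hf : ¬ IsConstant T f) :
    Nontrivial (TermModel T) := by
  by_contra h
  rw [not_nontrivial_iff_subsingleton] at h
  refine hf ⟨Term.var m, fun i => ?_, TermModel.mk_eq_mk.1 (Subsingleton.elim _ _)⟩
  simpa using i.2.ne

end TermModel

/-! ### Independent subsets of a model -/

section Independent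

variable {L : FirstOrder.Language.{u, v}} {T : EqTheory L} {S : Type w} [L.Structure S]

/-- `A` is independent with respect to the theory `T`: on `A`, homomorphisms to the term model can
be prescribed arbitrarily. As the term model detects provability, this says that `A` freely
generates a `T`-model. -/
def Independent (T : EqTheory L) (A : Set S) : Prop :=
  ∀ g : S → TermModel T, ∃ φ : S → TermModel T, IsHom L φ ∧ Set.EqOn φ g A

theorem Independent.mem_of_mem_closure [Nontrivial (TermModel T)] {A : Set S}
    (hA : Independent T A) {P : Set S} (hP : P ⊆ A) {a : S} (ha : a ∈ A)
    (haP : a ∈ Substructure.closure L P) : a ∈ P := by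
  classical
  obtain ⟨p, q, hpq⟩ := exists_pair_ne (TermModel T)
  by_contra hn
  obtain ⟨φ, hφ, hφA⟩ := hA fun _ => p
  obtain ⟨ψ, hψ, hψA⟩ := hA fun b => if b = a then q else p
  have h := hφ.eqOn_closure hψ (s := P) (fun b hb => by
    have hba : b ≠ a := by
      rintro rfl
      exact hn hb
    simp [hφA (hP hb), hψA (hP hb), hba]) haP
  refine hpq ?_
  simpa [hφA ha, hψA ha] using h

/-- Evaluating a nonconstant, nonprojecting operation at distinct independent elements leads out
of the independent set. -/
theorem Independent.funMap_notMem {A : Set S} (hA : Independent T A) {m : ℕ} {f : L.Functions m}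
    (hc : ¬ IsConstant T f) (hp : ¬ IsProjection T f) {v : Fin m → S}
    (hv : Function.Injective v) (hvA : ∀ i, v i ∈ A) : funMap f v ∉ A := by
  classical
  intro hmem
  obtain ⟨φ, hφ, hφA⟩ := hA fun b => if h : ∃ i, v i = b then TermModel.gen T (h.choose : Fin m)
    else TermModel.gen T m
  have hval : ∀ i, φ (v i) = TermModel.gen T (i : ℕ) := by
    intro i
    have h : ∃ j, v j = v i := ⟨i, rfl⟩
    rw [hφA (hvA i)]
    simp only [dif_pos h]
    rw [hv h.choose_spec]
  have hgen : φ (funMap f v) = TermModel.mk T (genericTerm f) := by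
    rw [hφ _ f]
    simp only [hval]
    exact TermModel.funMap_mk f _
  by_cases h : ∃ i, v i = funMap f v
  · obtain ⟨i, hi⟩ := h
    refine hp ⟨i, TermModel.mk_eq_mk.1 ?_⟩
    rw [← hgen, ← hi, hval]
    rfl
  · refine hc ⟨Term.var m, fun i => by simpa using i.2.ne, TermModel.mk_eq_mk.1 ?_⟩
    rw [← hgen, hφA hmem]
    simp only [dif_neg h]
    rfl

theorem Independent.funMap_notMem_closure {A : Set S} (hA : Independent T A) {m : ℕ}
    {f : L.Functions m} (hc : ¬ IsConstant T f) {v : Fin m → S}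
    (hv : Function.Injective v) (hvA : ∀ i, v i ∈ A) {P : Set S} (hP : P ⊆ A)
    (hvP : ∀ i, v i ∉ P) : funMap f v ∉ Substructure.closure L P := by
  classical
  intro hmem
  have hom : ∀ k : ℕ, ∃ φ : S → TermModel T, IsHom L φ ∧
      (∀ i, φ (v i) = TermModel.gen T (k + i)) ∧ ∀ b ∈ P, φ b = TermModel.gen T 0 := by
    intro k
    obtain ⟨φ, hφ, hφA⟩ := hA fun b => if h : ∃ i, v i = b then
      TermModel.gen T (k + (h.choose : Fin m)) else TermModel.gen T 0
    refine ⟨φ, hφ, fun i => ?_, fun b hb => ?_⟩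
    · have h : ∃ j, v j = v i := ⟨i, rfl⟩
      rw [hφA (hvA i)]
      simp only [dif_pos h]
      rw [hv h.choose_spec]
    · have h : ¬ ∃ j, v j = b := by
        rintro ⟨j, rfl⟩
        exact hvP j hb
      rw [hφA (hP hb)]
      simp only [dif_neg h]
  obtain ⟨φ, hφ, hφv, hφP⟩ := hom 0
  obtain ⟨ψ, hψ, hψv, hψP⟩ := hom m
  have h := hφ.eqOn_closure hψ (fun b hb => (hφP b hb).trans (hψP b hb).symm) hmem
  rw [hφ _ f, hψ _ f] at h
  simp only [hφv, hψv, zero_add] at h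
  refine hc ⟨Term.func f fun i => Term.var (m + i), fun i => ?_, TermModel.mk_eq_mk.1 ?_⟩
  · simp only [Term.varFinset, Finset.mem_biUnion, Finset.mem_univ, true_and,
      Finset.mem_singleton, not_exists]
    intro j
    omega
  · exact (TermModel.funMap_mk f _).symm.trans (h.trans (TermModel.funMap_mk f _))

end Independent

/-! ### Evaluation of closed terms -/

section Eval

variable {L : FirstOrder.Language.{u, v}}

/-- The value of a closed term over `L(γ)` in an `L`-structure, when the added constants are
interpreted by `v`. -/
def eval {γ : Type w} {M : Type w'} [L.Structure M] (v : γ → M) : ClosedTerm L γ → M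
  | Term.var a => a.elim
  | @Term.func _ _ _ (Sum.inl f) s => funMap f fun i => eval v (s i)
  | @Term.func _ _ 0 (Sum.inr c) _ => v c
  | @Term.func _ _ (_ + 1) (Sum.inr c) _ => isEmptyElim c

/-- Induction on closed terms over `L(γ)`. -/
theorem closedTerm_induction {γ : Type w} {p : ClosedTerm L γ → Prop}
    (happ : ∀ {m : ℕ} (f : L.Functions m) (s : Fin m → ClosedTerm L γ), (∀ i, p (s i)) → p (app f s))
    (hconst : ∀ c : γ, p (const c)) (t : ClosedTerm L γ) : p t := by
  induction t with
  | var a => exact a.elim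
  | @func m f s ih =>
    rcases f with f | c
    · exact happ f s ih
    · match m, c, s with
      | 0, c, s =>
        have hs : s = default := Subsingleton.elim _ _
        subst hs
        exact hconst c
      | _ + 1, c, _ => exact isEmptyElim c

section

variable {γ : Type w} {M : Type w'} [L.Structure M] (v : γ → M)

theorem eval_app {m : ℕ} (f : L.Functions m) (s : Fin m → ClosedTerm L γ) :
    eval v (app f s) = funMap f fun i => eval v (s i) := by
  rw [app, eval]

theorem eval_const (c : γ) : eval v (const (L := L) c) = v c := by
  rw [const]; rfl

end

theorem eval_substConst {γ : Type*} {δ : Type*} {M : Type*} [L.Structure M] (v : δ → M)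
    (σ : γ → ClosedTerm L δ) (t : ClosedTerm L γ) :
    eval v (substConst σ t) = eval (fun c => eval v (σ c)) t := by
  induction t using closedTerm_induction with
  | happ f s ih =>
    have : substConst σ (app f s) = app f fun i => substConst σ (s i) := by
      rw [app, substConst]
    rw [this, eval_app, eval_app]
    simp only [ih]
  | hconst c =>
    rw [eval_const]
    rfl

theorem eval_substX {n : ℕ} {γ : Type*} {M : Type*} [L.Structure M] (v : γ ⊕ Fin n → M)
    (t : ClosedTerm L (XY n)) (s : ClosedTerm L (γ ⊕ Fin n)) :
    eval v (substX t s) = eval (Sum.elim (fun _ => eval v s) fun j => v (Sum.inr j)) t := by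
  rw [substX, eval_substConst]
  congr 1
  funext c
  rcases c with c | c
  · rfl
  · exact eval_const _ _

theorem IsHom.eval {γ : Type*} {M N : Type*} [L.Structure M] [L.Structure N] {φ : M → N}
    (hφ : IsHom L φ) (v : γ → M) (t : ClosedTerm L γ) :
    φ (EqLogic.eval v t) = EqLogic.eval (fun c => φ (v c)) t := by
  induction t using closedTerm_induction with
  | happ f s ih =>
    rw [eval_app, eval_app, hφ _ f]
    simp only [ih]
  | hconst c => rw [eval_const, eval_const]

theorem ProvesClosed.sound {T : EqTheory L} {γ : Type*} {M : Type*} [L.Structure M]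
    (hM : Models T M) {s t : ClosedTerm L γ} (h : ProvesClosed T γ s t) (v : γ → M) :
    eval v s = eval v t := by
  let _ : (constantsOn γ).Structure M := constantsOn.structure v
  have key : ∀ (e : ℕ → M) (t : ClosedTerm L γ),
      (t.relabel Empty.elim : L[[γ]].Term ℕ).realize e = eval v t := by
    intro e t
    induction t using closedTerm_induction with
    | happ f s ih =>
      rw [eval_app]
      simp only [← ih]
      rfl
    | hconst c =>
      rw [eval_const]
      rfl
  rcases isEmpty_or_nonempty M with hM' | ⟨⟨a⟩⟩
  · exact isEmptyElim (eval v s)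
  · rw [← key fun _ => a, ← key fun _ => a]
    exact Proves.sound ((models_map (L.lhomWithConstants γ) T).2 hM) h _

end Eval

/-! ### Free models as structures -/

section FreeModel

variable {L : FirstOrder.Language.{u, v}} {T : EqTheory L} {γ : Type w}

theorem cls_eq_cls {s t : ClosedTerm L γ} : cls T s = cls T t ↔ ProvesClosed T γ s t :=
  Quotient.eq (r := closedSetoid T γ)

theorem cls_out (a : FreeModel T γ) : cls T (Quotient.out a) = a :=
  Quotient.out_eq a

noncomputable instance : L.Structure (FreeModel T γ) where
  funMap f a := cls T (app f fun i => Quotient.out (a i))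
  RelMap _ _ := False

theorem funMap_cls {m : ℕ} (f : L.Functions m) (t : Fin m → ClosedTerm L γ) :
    funMap f (fun i => cls T (t i)) = cls T (app f t) :=
  cls_eq_cls.2 (Proves.congr (L := L[[γ]]) (Sum.inl f) _ _ fun _ => cls_eq_cls.1 (cls_out _))

theorem eval_cls_const (t : ClosedTerm L γ) : eval (fun c => cls T (const c)) t = cls T t := by
  induction t using closedTerm_induction with
  | happ f s ih => simp only [eval_app, ih, funMap_cls]
  | hconst c => exact eval_const _ _

theorem freeModel_models : Models T (FreeModel T γ) := by
  have key : ∀ (v : ℕ → FreeModel T γ) (t : L.Term ℕ),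
      t.realize v = cls T (((L.lhomWithConstants γ).onTerm t).subst fun i => Quotient.out (v i)) := by
    intro v t
    induction t with
    | var i => exact (cls_out _).symm
    | func f ts ih =>
      simp only [Term.realize_func, ih, funMap_cls]
      rfl
  have relabel_subst : ∀ (t : L[[γ]].Term ℕ) (σ : ℕ → ClosedTerm L γ),
      ((t.subst σ).relabel Empty.elim : L[[γ]].Term ℕ) =
        t.subst fun i => (σ i).relabel Empty.elim := by
    intro t σ
    induction t with
    | var i => rfl
    | func f ts ih => simp only [Term.subst, Term.relabel, ih]
  intro e he v
  rw [key, key]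
  refine cls_eq_cls.2 ?_
  rw [ProvesClosed, relabel_subst, relabel_subst]
  exact Proves.ax (T := T.map (L.lhomWithConstants γ)) _ _ ⟨e, he, rfl⟩ _

end FreeModel

/-! ### Alternation layers -/

section Layers

variable {L₁ : FirstOrder.Language.{u₁, v₁}} {L₂ : FirstOrder.Language.{u₂, v₂}} {S : Type w}
  [L₁.Structure S] [L₂.Structure S]

/-- The two alternating chains of closures of `G`, built simultaneously: the first component at
stage `k + 1` is the `L₁`-closure of the second component at stage `k`, and vice versa. -/
def layers (L₁ : FirstOrder.Language.{u₁, v₁}) (L₂ : FirstOrder.Language.{u₂, v₂}) {S : Type w}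
    [L₁.Structure S] [L₂.Structure S] (G : Set S) : ℕ → Set S × Set S
  | 0 => (G, G)
  | k + 1 => (Substructure.closure L₁ (layers L₁ L₂ G k).2,
      Substructure.closure L₂ (layers L₁ L₂ G k).1)

/-- The elements obtained from `G` by at most `k` alternating blocks of operations, the outermost
block consisting of operations of `L₁`. -/
def layer (L₁ : FirstOrder.Language.{u₁, v₁}) (L₂ : FirstOrder.Language.{u₂, v₂}) {S : Type w}
    [L₁.Structure S] [L₂.Structure S] (G : Set S) (k : ℕ) : Set S :=
  (layers L₁ L₂ G k).1

variable {G : Set S}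

theorem layers_swap (k : ℕ) : layers L₂ L₁ G k = (layers L₁ L₂ G k).swap := by
  induction k with
  | zero => rfl
  | succ k ih => simp only [layers, ih, Prod.swap]

theorem layer_succ (k : ℕ) :
    layer L₁ L₂ G (k + 1) = Substructure.closure L₁ (layer L₂ L₁ G k) := by
  rw [layer, layer, layers_swap]
  rfl

theorem layer_subset_swap (k : ℕ) : layer L₂ L₁ G k ⊆ layer L₁ L₂ G (k + 1) := by
  rw [layer_succ]
  exact Substructure.subset_closure

theorem layer_subset_succ (k : ℕ) :
    layer L₁ L₂ G k ⊆ layer L₁ L₂ G (k + 1) ∧ layer L₂ L₁ G k ⊆ layer L₂ L₁ G (k + 1) := by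
  induction k with
  | zero => exact ⟨layer_subset_swap (L₁ := L₁) (L₂ := L₂) 0, layer_subset_swap (L₁ := L₂) (L₂ := L₁) 0⟩
  | succ k ih =>
    simp only [layer_succ] at ih ⊢
    exact ⟨Substructure.closure_mono ih.2, Substructure.closure_mono ih.1⟩

theorem layer_mono : Monotone (layer L₁ L₂ G) :=
  monotone_nat_of_le_succ fun k => (layer_subset_succ k).1

theorem funMap_mem_layer_succ {m : ℕ} (f : L₁.Functions m) {a : Fin m → S} {k : ℕ}
    (ha : ∀ i, a i ∈ layer L₁ L₂ G (k + 1)) : funMap f a ∈ layer L₁ L₂ G (k + 1) := by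
  simp only [layer_succ] at ha ⊢
  exact (Substructure.closure L₁ _).fun_mem f a ha

/-- Every value of a term of the combined language at elements of `G` lies in some layer. -/
theorem exists_eval_mem_layer {γ : Type*} (v : γ → S) (hv : ∀ c, v c ∈ G)
    (t : ClosedTerm (L₁.sum L₂) γ) : ∃ k, eval v t ∈ layer L₁ L₂ G k := by
  induction t using closedTerm_induction with
  | @happ m f s ih =>
    choose k hk using ih
    have hK : ∀ i, eval v (s i) ∈ layer L₁ L₂ G (Finset.univ.sup k + 1) := fun i =>
      layer_mono ((Finset.le_sup (Finset.mem_univ i)).trans (Nat.le_succ _)) (hk i)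
    rw [eval_app]
    rcases f with f | f
    · exact ⟨_, funMap_mem_layer_succ f hK⟩
    · exact ⟨_, layer_subset_swap _ (funMap_mem_layer_succ f fun i => layer_subset_swap _ (hK i))⟩
  | hconst c =>
    refine ⟨0, ?_⟩
    rw [eval_const]
    exact hv c

theorem mem_layer_of_isHom {φ : S → S} (h₁ : IsHom L₁ φ) (h₂ : IsHom L₂ φ)
    (hG : ∀ a ∈ G, φ a ∈ G) (k : ℕ) :
    (∀ a ∈ layer L₁ L₂ G k, φ a ∈ layer L₁ L₂ G k) ∧
      ∀ a ∈ layer L₂ L₁ G k, φ a ∈ layer L₂ L₁ G k := by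
  induction k with
  | zero => exact ⟨hG, hG⟩
  | succ k ih =>
    simp only [layer_succ]
    exact ⟨fun a => h₁.mem_closure_image fun b hb => Substructure.subset_closure (ih.2 b hb),
      fun a => h₂.mem_closure_image fun b hb => Substructure.subset_closure (ih.1 b hb)⟩

/-- Substituting elements of the first `L₂`-layer for the generators increases the number of
alternations by at most one. -/
theorem mem_layer_succ_of_isHom {φ : S → S} (h₁ : IsHom L₁ φ) (h₂ : IsHom L₂ φ)
    (hG : ∀ a ∈ G, φ a ∈ layer L₂ L₁ G 1) (k : ℕ) :
    (∀ a ∈ layer L₁ L₂ G k, φ a ∈ layer L₁ L₂ G (k + 1) ∪ layer L₂ L₁ G 1) ∧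
      ∀ a ∈ layer L₂ L₁ G k, φ a ∈ layer L₂ L₁ G (k + 1) := by
  induction k with
  | zero => exact ⟨fun a ha => Or.inr (hG a ha), hG⟩
  | succ k ih =>
    refine ⟨fun a ha => Or.inl ?_, fun a ha => ?_⟩
    · rw [layer_succ] at ha ⊢
      exact h₁.mem_closure_image (fun b hb => Substructure.subset_closure (ih.2 b hb)) ha
    rw [layer_succ] at ha
    rw [layer_succ (k + 1)]
    refine h₂.mem_closure_image (fun b hb => ?_) ha
    rw [← SetLike.mem_coe, ← layer_succ]
    rcases ih.1 b hb with h | h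
    · exact layer_subset_swap _ h
    · exact layer_mono (by omega) h

end Layers

/-! ### Layers relative to two independent sets -/

section Independent

variable {L₁ : FirstOrder.Language.{u₁, v₁}} {L₂ : FirstOrder.Language.{u₂, v₂}}
  {T₁ : EqTheory L₁} {T₂ : EqTheory L₂} [Nontrivial (TermModel T₁)] [Nontrivial (TermModel T₂)]
  {S : Type w} [L₁.Structure S] [L₂.Structure S] {A B G : Set S}

theorem layer_succ_subset_closure_aux (hB : Independent T₂ B) (hAB : A ∪ B = Set.univ)
    (hGA : G ⊆ A) (k : ℕ)
    (ih : ∀ j < k, layer L₁ L₂ G (j + 1) ⊆ Substructure.closure L₁ (layer L₂ L₁ G j ∩ A) ∧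
      layer L₂ L₁ G (j + 1) ⊆ Substructure.closure L₂ (layer L₁ L₂ G j ∩ B)) :
    layer L₁ L₂ G (k + 1) ⊆ Substructure.closure L₁ (layer L₂ L₁ G k ∩ A) := by
  rw [layer_succ]
  refine Substructure.closure_le.2 fun z hz => ?_
  by_cases hzA : z ∈ A
  · exact Substructure.subset_closure ⟨hz, hzA⟩
  have hzB : z ∈ B := ((Set.ext_iff.1 hAB z).2 trivial).resolve_left hzA
  -- As `z` is independent for `T₂`, it already occurs two layers below.
  match k with
  | 0 => exact absurd (hGA hz) hzA
  | k + 1 =>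
    have hz₁ := (hB.mem_of_mem_closure Set.inter_subset_right hzB
      ((ih k (by omega)).2 hz)).1
    match k with
    | 0 => exact absurd (hGA hz₁) hzA
    | k + 1 =>
      exact Substructure.closure_mono (Set.inter_subset_inter_left _ (layer_mono (by omega)))
        ((ih k (by omega)).1 hz₁)

/-- Elements outside `A` are redundant in generating the next `L₁`-layer, and elements outside `B`
are redundant in generating the next `L₂`-layer. -/
theorem layer_succ_subset_closure (hA : Independent T₁ A) (hB : Independent T₂ B)
    (hAB : A ∪ B = Set.univ) (hGA : G ⊆ A) (hGB : G ⊆ B) (k : ℕ) :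
    layer L₁ L₂ G (k + 1) ⊆ Substructure.closure L₁ (layer L₂ L₁ G k ∩ A) ∧
      layer L₂ L₁ G (k + 1) ⊆ Substructure.closure L₂ (layer L₁ L₂ G k ∩ B) := by
  induction k using Nat.strong_induction_on with
  | _ k ih =>
    exact ⟨layer_succ_subset_closure_aux hB hAB hGA k ih,
      layer_succ_subset_closure_aux hA (by rwa [Set.union_comm]) hGB k
        fun j hj => (ih j hj).symm⟩

/-- Applying a nonconstant, nonprojecting operation of `L₂` to distinct elements, each of which
needs exactly `k + 1` alternations with an operation of `L₁` outermost, produces an element that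
cannot be rewritten with an operation of `L₁` outermost and at most `k + 2` alternations. -/
theorem funMap_notMem_layer (hA : Independent T₁ A) (hB : Independent T₂ B)
    (hAB : A ∪ B = Set.univ) (hGA : G ⊆ A) (hGB : G ⊆ B) {m : ℕ} {f : L₂.Functions m}
    (hc : ¬ IsConstant T₂ f) (hp : ¬ IsProjection T₂ f) {v : Fin m → S}
    (hv : Function.Injective v) {k : ℕ} (hv₀ : ∀ i, v i ∈ layer L₁ L₂ G (k + 1))
    (hv₁ : ∀ i, v i ∉ layer L₁ L₂ G k) (hv₂ : ∀ i, v i ∉ layer L₂ L₁ G k) :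
    funMap f v ∉ layer L₁ L₂ G (k + 2) := by
  intro hr
  have key := layer_succ_subset_closure hA hB hAB hGA hGB
  have hor : ∀ z, z ∈ A ∨ z ∈ B := fun z => (Set.ext_iff.1 hAB z).2 trivial
  have hvB : ∀ i, v i ∈ B := fun i => (hor _).resolve_left fun hvA =>
    hv₂ i (hA.mem_of_mem_closure Set.inter_subset_right hvA ((key k).1 (hv₀ i))).1
  have hrA : funMap f v ∈ A := (hor _).resolve_right (hB.funMap_notMem hc hp hv hvB)
  have hr' := (hA.mem_of_mem_closure Set.inter_subset_right hrA ((key (k + 1)).1 hr)).1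
  exact hB.funMap_notMem_closure hc hv hvB Set.inter_subset_right (fun i hi => hv₁ i hi.1)
    ((key k).2 hr')

end Independent

/-! ### Natural operations commuting with all operations -/

section Natural

variable {L₁ : FirstOrder.Language.{u₁, v₁}} {L₂ : FirstOrder.Language.{u₂, v₂}}
  {T₁ : EqTheory L₁} {T₂ : EqTheory L₂} [Nontrivial (TermModel T₁)] [Nontrivial (TermModel T₂)]
  {S : Type w} [L₁.Structure S] [L₂.Structure S] {A B : Set S} {Y : Type} {x : ℕ ⊕ Y → S}
  {τ : S → S}

/-- A natural injective operation commuting with a nontrivial operation of `L₂` does not send a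
generator to an element whose alternation depth is attained with an operation of `L₁`
outermost. -/
theorem mem_layer_of_natural (hA : Independent T₁ A) (hB : Independent T₂ B)
    (hAB : A ∪ B = Set.univ) (hxA : Set.range x ⊆ A) (hxB : Set.range x ⊆ B)
    (hx : Function.Injective x)
    (hext : ∀ s : ℕ ⊕ Y → S, ∃ φ : S → S, IsHom L₁ φ ∧ IsHom L₂ φ ∧ ∀ i, φ (x i) = s i)
    (hτ : Function.Injective τ) (hτ₂ : IsHom L₂ τ)
    (hnat : ∀ φ : S → S, IsHom L₁ φ → IsHom L₂ φ → (∀ y, φ (x (Sum.inr y)) = x (Sum.inr y)) →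
      ∀ a, φ (τ a) = τ (φ a))
    {m : ℕ} {f : L₂.Functions m} (hc : ¬ IsConstant T₂ f) (hp : ¬ IsProjection T₂ f) {k : ℕ}
    (h₀ : τ (x (Sum.inl 0)) ∈ layer L₁ L₂ (Set.range x) (k + 1)) :
    τ (x (Sum.inl 0)) ∈ layer L₁ L₂ (Set.range x) k ∪ layer L₂ L₁ (Set.range x) k := by
  classical
  by_contra hn
  rw [Set.mem_union, not_or] at hn
  -- Transposing two generators shows that all of them behave as the generator `x (inl 0)`.
  have hswap : ∀ i : ℕ, ∃ φ : S → S, IsHom L₁ φ ∧ IsHom L₂ φ ∧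
      (∀ a ∈ Set.range x, φ a ∈ Set.range x) ∧
      φ (τ (x (Sum.inl 0))) = τ (x (Sum.inl i)) ∧ φ (τ (x (Sum.inl i))) = τ (x (Sum.inl 0)) := by
    intro i
    obtain ⟨φ, h₁, h₂, hφ⟩ := hext fun c => x (Equiv.swap (Sum.inl 0) (Sum.inl i) c)
    have hy : ∀ y, φ (x (Sum.inr y)) = x (Sum.inr y) := fun y => by
      rw [hφ, Equiv.swap_apply_of_ne_of_ne (by simp) (by simp)]
    refine ⟨φ, h₁, h₂, ?_, ?_, ?_⟩
    · rintro _ ⟨c, rfl⟩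
      exact ⟨_, (hφ c).symm⟩
    · rw [hnat φ h₁ h₂ hy, hφ, Equiv.swap_apply_left]
    · rw [hnat φ h₁ h₂ hy, hφ, Equiv.swap_apply_right]
  obtain ⟨φ, h₁, h₂, hφ⟩ := hext (Function.update x (Sum.inl 0)
    (funMap f fun i : Fin m => x (Sum.inl (i : ℕ))))
  have hφ₀ : φ (x (Sum.inl 0)) = funMap f fun i : Fin m => x (Sum.inl (i : ℕ)) := by
    rw [hφ, Function.update_self]
  have hφ₁ : ∀ c, c ≠ Sum.inl 0 → φ (x c) = x c := fun c hc' => by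
    rw [hφ, Function.update_of_ne hc']
  have hφG : ∀ a ∈ Set.range x, φ a ∈ layer L₂ L₁ (Set.range x) 1 := by
    rintro _ ⟨c, rfl⟩
    by_cases hc' : c = Sum.inl 0
    · rw [hc', hφ₀]
      exact funMap_mem_layer_succ f fun i => layer_subset_swap 0 ⟨_, rfl⟩
    · rw [hφ₁ c hc']
      exact layer_subset_swap 0 ⟨_, rfl⟩
  have hmem := (mem_layer_succ_of_isHom h₁ h₂ hφG (k + 1)).1 _ h₀
  rw [hnat φ h₁ h₂ fun y => hφ₁ _ (by simp), hφ₀, hτ₂ _ f] at hmem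
  refine funMap_notMem_layer hA hB hAB hxA hxB hc hp (k := k)
    (v := fun i : Fin m => τ (x (Sum.inl (i : ℕ)))) ?_ ?_ ?_ ?_ ?_
  · exact hτ.comp (hx.comp (Sum.inl_injective.comp Fin.val_injective))
  · intro i
    obtain ⟨ψ, g₁, g₂, hG, hψ, -⟩ := hswap i
    exact hψ ▸ (mem_layer_of_isHom g₁ g₂ hG (k + 1)).1 _ h₀
  · intro i hi
    obtain ⟨ψ, g₁, g₂, hG, -, hψ⟩ := hswap i
    exact hn.1 (hψ ▸ (mem_layer_of_isHom g₁ g₂ hG k).1 _ hi)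
  · intro i hi
    obtain ⟨ψ, g₁, g₂, hG, -, hψ⟩ := hswap i
    exact hn.2 (hψ ▸ (mem_layer_of_isHom g₁ g₂ hG k).2 _ hi)
  · rcases hmem with h | h
    · exact h
    · exact layer_mono (by omega) (layer_subset_swap 1 h)

/-- A natural injective operation that commutes with all operations of both languages fixes the
generators. -/
theorem natural_eq_self (hA : Independent T₁ A) (hB : Independent T₂ B)
    (hAB : A ∪ B = Set.univ) (hxA : Set.range x ⊆ A) (hxB : Set.range x ⊆ B)
    (hx : Function.Injective x)
    (hext : ∀ s : ℕ ⊕ Y → S, ∃ φ : S → S, IsHom L₁ φ ∧ IsHom L₂ φ ∧ ∀ i, φ (x i) = s i)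
    (hτ : Function.Injective τ) (hτ₁ : IsHom L₁ τ) (hτ₂ : IsHom L₂ τ)
    (hnat : ∀ φ : S → S, IsHom L₁ φ → IsHom L₂ φ → (∀ y, φ (x (Sum.inr y)) = x (Sum.inr y)) →
      ∀ a, φ (τ a) = τ (φ a))
    (hf₁ : ∃ (m : ℕ) (f : L₁.Functions m), ¬ IsConstant T₁ f ∧ ¬ IsProjection T₁ f)
    (hf₂ : ∃ (m : ℕ) (f : L₂.Functions m), ¬ IsConstant T₂ f ∧ ¬ IsProjection T₂ f)
    (hmem : ∃ k, τ (x (Sum.inl 0)) ∈ layer L₁ L₂ (Set.range x) k) :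
    τ (x (Sum.inl 0)) = x (Sum.inl 0) := by
  classical
  obtain ⟨m₁, f₁, hc₁, hp₁⟩ := hf₁
  obtain ⟨m₂, f₂, hc₂, hp₂⟩ := hf₂
  obtain ⟨k, hk⟩ := hmem
  have hdesc : ∀ k, τ (x (Sum.inl 0)) ∈
      layer L₁ L₂ (Set.range x) k ∪ layer L₂ L₁ (Set.range x) k →
      τ (x (Sum.inl 0)) ∈ Set.range x := by
    intro k
    induction k with
    | zero => exact fun h => h.elim id id
    | succ k ih =>
      rintro (h | h)
      · exact ih (mem_layer_of_natural hA hB hAB hxA hxB hx hext hτ hτ₂ hnat hc₂ hp₂ h)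
      · refine ih (Or.symm ?_)
        exact mem_layer_of_natural hB hA (by rwa [Set.union_comm]) hxB hxA hx
          (fun s => (hext s).imp fun φ h => ⟨h.2.1, h.1, h.2.2⟩) hτ hτ₁
          (fun φ h₁ h₂ => hnat φ h₂ h₁) hc₁ hp₁ h
  obtain ⟨c, hc⟩ := hdesc k (Or.inl hk)
  -- Moving `x (inl 0)` to a fresh generator moves its image, by injectivity of `τ`.
  by_contra hne
  have hc0 : c ≠ Sum.inl 0 := by
    rintro rfl
    exact hne hc.symm
  obtain ⟨φ, h₁, h₂, hφ⟩ := hext (Function.update x (Sum.inl 0) (x (Sum.inl 1)))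
  have h := hnat φ h₁ h₂ (fun y => by rw [hφ, Function.update_of_ne (by simp)]) (x (Sum.inl 0))
  rw [hφ, Function.update_self, ← hc, hφ, Function.update_of_ne hc0, hc] at h
  exact zero_ne_one (Sum.inl_injective (hx (hτ h)))

end Natural

/-! ### Labelled free models -/

section Labelled

variable {L : FirstOrder.Language.{u, v}} (T : EqTheory L) (V : Type w) (F : Type w')

/-- The product of `F` with the power of the term model indexed by all valuations of `V`. The
substructure generated by the pairs `Labelled.gen ρ a` is the free `T`-model on `V`, each of its
elements carrying as a label its image in `F` under the homomorphism extending `ρ : V → F`. -/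
def Labelled := ((V → TermModel T) → TermModel T) × F

variable {T V F}

noncomputable instance [L.Structure F] : L.Structure (Labelled T V F) where
  funMap f a := (fun e => funMap f fun i => (a i).1 e, funMap f fun i => (a i).2)
  RelMap _ _ := False

/-- The generator of `Labelled T V F` given by `a : V`, with label `ρ a`. -/
def Labelled.gen (ρ : V → F) (a : V) : Labelled T V F := (fun e => e a, ρ a)

theorem Labelled.isHom_fst_apply [L.Structure F] (e : V → TermModel T) :
    IsHom L fun w : Labelled T V F => w.1 e := fun _ _ _ => rfl

theorem Labelled.isHom_snd [L.Structure F] : IsHom L fun w : Labelled T V F => w.2 :=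
  fun _ _ _ => rfl

theorem Labelled.models [L.Structure F] (hF : Models T F) : Models T (Labelled T V F) := by
  intro e he v
  refine Prod.ext (funext fun g => ?_) ?_
  · have h := isHom_fst_apply (F := F) g
    exact (h.realize v e.1).trans ((TermModel.models e he _).trans (h.realize v e.2).symm)
  · have h := isHom_snd (T := T) (V := V) (F := F)
    exact (h.realize v e.1).trans ((hF e he _).trans (h.realize v e.2).symm)

theorem Labelled.gen_injective [Nontrivial (TermModel T)] (ρ : V → F) :
    Function.Injective (Labelled.gen (T := T) ρ) := by
  classical
  intro a b hab
  obtain ⟨p, q, hpq⟩ := exists_pair_ne (TermModel T)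
  by_contra hne
  have h : (if a = a then p else q) = if b = a then p else q :=
    congrFun (congrArg Prod.fst hab) fun c => if c = a then p else q
  rw [if_pos rfl, if_neg (Ne.symm hne)] at h
  exact hpq h

theorem Labelled.mem_of_gen_mem_closure [Nontrivial (TermModel T)] [L.Structure F] {ρ : V → F}
    {R : Set V} {a : V}
    (h : Labelled.gen (T := T) ρ a ∈ Substructure.closure L (Labelled.gen ρ '' R)) : a ∈ R := by
  classical
  obtain ⟨p, q, hpq⟩ := exists_pair_ne (TermModel T)
  by_contra hn
  have := (isHom_fst_apply (F := F) fun _ : V => p).eqOn_closure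
    (isHom_fst_apply fun c => if c = a then q else p) (s := Labelled.gen ρ '' R) (by
      rintro _ ⟨c, hc, rfl⟩
      have hca : c ≠ a := by
        rintro rfl
        exact hn hc
      simp [Labelled.gen, hca]) h
  refine hpq ?_
  simpa [Labelled.gen] using this

/-- A bijection of `S` with the substructure generated by a set of generators turns `S` into a
model in which the elements corresponding to generators are independent. -/
theorem Labelled.exists_structure [L.Structure F] (hF : Models T F) {ρ : V → F} {R : Set V}
    {S : Type*} {κ : S → Labelled T V F} (hinj : Function.Injective κ)
    (hrange : Set.range κ = Substructure.closure L (Labelled.gen (T := T) ρ '' R)) :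
    ∃ _ : L.Structure S, Models T S ∧ Independent T {s | κ s ∈ Set.range (Labelled.gen ρ)} ∧
      IsHom L fun s => (κ s).2 := by
  classical
  have hex : ∀ {m : ℕ} (f : L.Functions m) (a : Fin m → S),
      ∃ s, κ s = funMap f fun i => κ (a i) := by
    intro m f a
    have : funMap f (fun i => κ (a i)) ∈ Set.range κ := by
      rw [hrange]
      refine (Substructure.closure L _).fun_mem f _ fun i => ?_
      have ha : κ (a i) ∈ Set.range κ := ⟨a i, rfl⟩
      rwa [hrange] at ha
    exact this
  let st : L.Structure S :=
    { funMap := fun f a => (hex f a).choose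
      RelMap := fun _ _ => False }
  have hκ : IsHom L κ := fun m f a => (hex f a).choose_spec
  refine ⟨st, ?_, ?_, isHom_snd.comp hκ⟩
  · exact Models.of_isHom (ι := Unit) (fun _ => models hF) (fun _ => κ) (fun _ => hκ)
      fun a b h => hinj (h ())
  · intro g
    rcases isEmpty_or_nonempty S with hS | ⟨⟨s₀⟩⟩
    · exact ⟨g, fun m f a => isEmptyElim (funMap f a), fun s => isEmptyElim s⟩
    refine ⟨_, (isHom_fst_apply fun c => if h : ∃ s, κ s = gen ρ c then g h.choose else g s₀).comp
      hκ, ?_⟩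
    rintro s ⟨c, hc⟩
    have h : ∃ s, κ s = gen ρ c := ⟨s, hc.symm⟩
    have hs : h.choose = s := hinj (h.choose_spec.trans hc)
    rw [Function.comp_apply, ← hc]
    change (if h : ∃ s, κ s = gen ρ c then g h.choose else g s₀) = g s
    rw [dif_pos h, hs]

end Labelled

/-! ### Codes of non-generators -/

section Codes

variable {L : FirstOrder.Language.{u, v}} {T : EqTheory L} {X : Type*} {U : Type*} {F : Type*}
  [L.Structure F]

/-- The codes under `j` of those elements generated by `X ∪ P` that are not generators. -/
def codes (ρ : X ⊕ U → F) (j : Labelled T (X ⊕ U) F → U) (P : Set U) : Set U :=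
  {u | ∃ w ∈ Substructure.closure L (Labelled.gen ρ '' (Set.range Sum.inl ∪ Sum.inr '' P)),
    w ∉ Set.range (Labelled.gen ρ) ∧ j w = u}

theorem codes_mono (ρ : X ⊕ U → F) (j : Labelled T (X ⊕ U) F → U) : Monotone (codes ρ j) := by
  rintro P Q hPQ _ ⟨w, hw, hn, rfl⟩
  exact ⟨w, Substructure.closure_mono
    (Set.image_mono (Set.union_subset_union_right _ (Set.image_mono hPQ))) hw, hn, rfl⟩

/-- The model generated by `X ∪ P` is in bijection with the disjoint union of `X`, `P` and the
codes of its non-generators. -/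
theorem exists_decoding [Nontrivial (TermModel T)] {ρ : X ⊕ U → F}
    {j : Labelled T (X ⊕ U) F → U}
    (hj : Set.InjOn j (Substructure.closure L (Set.range (Labelled.gen (T := T) ρ))))
    (hlabel : ∀ w, ρ (Sum.inr (j w)) = w.2) {P Q : Set U} (hQ : Q = codes ρ j P) :
    ∃ κ : X ⊕ P ⊕ Q → Labelled T (X ⊕ U) F, Function.Injective κ ∧
      Set.range κ =
        Substructure.closure L
          (Labelled.gen (T := T) ρ '' (Set.range Sum.inl ∪ Sum.inr '' P)) ∧
      (∀ i, κ (Sum.inl i) = Labelled.gen ρ (Sum.inl i)) ∧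
      (∀ p : P, κ (Sum.inr (Sum.inl p)) = Labelled.gen ρ (Sum.inr p)) ∧
      ∀ s, (κ s).2 = ρ (Sum.map id (Sum.elim Subtype.val Subtype.val) s) := by
  have hle : ∀ w ∈ Substructure.closure L (Labelled.gen (T := T) ρ ''
      (Set.range Sum.inl ∪ Sum.inr '' P)),
      w ∈ Substructure.closure L (Set.range (Labelled.gen (T := T) ρ)) :=
    fun w hw => Substructure.closure_mono (Set.image_subset_range _ _) hw
  have hex : ∀ u : Q, ∃ w ∈ Substructure.closure L
      (Labelled.gen ρ '' (Set.range Sum.inl ∪ Sum.inr '' P)),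
      w ∉ Set.range (Labelled.gen (T := T) ρ) ∧ j w = u :=
    fun u => (Set.ext_iff.1 hQ u).1 u.2
  choose d hd hdn hdj using hex
  have hgen := Labelled.gen_injective (T := T) ρ
  have hdinj : Function.Injective d := fun u u' h => Subtype.ext (by rw [← hdj, ← hdj, h])
  refine ⟨Sum.elim (fun i => Labelled.gen ρ (Sum.inl i))
    (Sum.elim (fun p => Labelled.gen ρ (Sum.inr p)) d), ?_, ?_, fun _ => rfl, fun _ => rfl, ?_⟩
  · refine (hgen.comp Sum.inl_injective).sumElim
      ((hgen.comp (Sum.inr_injective.comp Subtype.val_injective)).sumElim hdinj ?_) ?_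
    · exact fun p u h => hdn u ⟨_, h⟩
    · rintro i (p | u) h
      · exact Sum.inl_ne_inr (hgen h)
      · exact hdn u ⟨_, h⟩
  · refine Set.Subset.antisymm ?_ fun w hw => ?_
    · rintro _ ⟨i | p | u, rfl⟩
      · exact Substructure.subset_closure ⟨_, Or.inl ⟨i, rfl⟩, rfl⟩
      · exact Substructure.subset_closure ⟨_, Or.inr ⟨p, p.2, rfl⟩, rfl⟩
      · exact hd u
    · by_cases hwg : w ∈ Set.range (Labelled.gen (T := T) ρ)
      · obtain ⟨a, rfl⟩ := hwg
        rcases Labelled.mem_of_gen_mem_closure hw with ⟨i, rfl⟩ | ⟨p, hp, rfl⟩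
        · exact ⟨Sum.inl i, rfl⟩
        · exact ⟨Sum.inr (Sum.inl ⟨p, hp⟩), rfl⟩
      · have hwQ : j w ∈ Q := hQ ▸ ⟨w, hw, hwg, rfl⟩
        exact ⟨Sum.inr (Sum.inr ⟨j w, hwQ⟩), hj (hle _ (hd _)) (hle _ hw) (hdj _)⟩
  · rintro (i | p | u)
    · rfl
    · rfl
    · change (d u).2 = ρ (Sum.inr u)
      rw [← hdj, hlabel]

end Codes

/-! ### A model with two independent generating sets -/

section Model

theorem exists_injOn_closure {L : FirstOrder.Language.{u, v}} {M K : Type w} [L.Structure M]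
    [Infinite K] {s : Set M} (hs : Cardinal.mk s ≤ Cardinal.mk K)
    (hL : Nonempty ((Σ i, L.Functions i) ↪ K)) :
    ∃ j : M → K, Set.InjOn j (Substructure.closure L s) := by
  have hK : Cardinal.aleph0 ≤ Cardinal.lift.{u} (Cardinal.mk K) :=
    Cardinal.aleph0_le_lift.2 (Cardinal.aleph0_le_mk K)
  have h : Cardinal.mk (Substructure.closure L s) ≤ Cardinal.mk K := by
    rw [← Cardinal.lift_le.{u}]
    refine Substructure.lift_card_closure_le.trans (max_le hK ?_)
    exact Cardinal.add_le_of_le hK (Cardinal.lift_le.2 hs) (Cardinal.lift_mk_le'.2 hL)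
  obtain ⟨e⟩ := h
  have : Nonempty K := inferInstance
  obtain ⟨a⟩ := this
  classical
  refine ⟨fun w => if h : w ∈ Substructure.closure L s then e ⟨w, h⟩ else a, fun w hw w' hw' h => ?_⟩
  simp only [dif_pos (SetLike.mem_coe.1 hw), dif_pos (SetLike.mem_coe.1 hw')] at h
  exact congrArg Subtype.val (e.injective h)

variable {L₁ : FirstOrder.Language.{u₁, v₁}} {L₂ : FirstOrder.Language.{u₂, v₂}}
  {T₁ : EqTheory L₁} {T₂ : EqTheory L₂}

/-- There is a common model `S` of `T₁` and `T₂` with a set `A` independent for `T₁` and a set `B`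
independent for `T₂`, such that `A ∪ B` is everything, `A ∩ B` contains a copy of `X`, and `S` maps
to a prescribed common model with prescribed values on `X`. -/
theorem exists_model [Nontrivial (TermModel T₁)] [Nontrivial (TermModel T₂)] {X : Type}
    [Countable X] {F : Type (max u₁ u₂)} [L₁.Structure F] [L₂.Structure F] (hF₁ : Models T₁ F)
    (hF₂ : Models T₂ F) (g : X → F) :
    ∃ (S : Type (max u₁ u₂)) (_ : L₁.Structure S) (_ : L₂.Structure S) (A B : Set S) (x : X → S)
      (ρ : S → F), Models T₁ S ∧ Models T₂ S ∧ Independent T₁ A ∧ Independent T₂ B ∧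
      A ∪ B = Set.univ ∧ Set.range x ⊆ A ∧ Set.range x ⊆ B ∧ Function.Injective x ∧
      IsHom L₁ ρ ∧ IsHom L₂ ρ ∧ ∀ i, ρ (x i) = g i := by
  let K : Type (max u₁ u₂) := ℕ ⊕ F ⊕ (Σ i, L₁.Functions i) ⊕ (Σ i, L₂.Functions i)
  let V : Type (max u₁ u₂) := X ⊕ F × K
  -- The first component of a code is its label.
  let lab : V → F := Sum.elim g Prod.fst
  have hK : Cardinal.aleph0 ≤ Cardinal.mk K := Cardinal.aleph0_le_mk K
  have hV : Cardinal.mk V ≤ Cardinal.mk K := by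
    rw [Cardinal.mk_sum, Cardinal.mk_prod, Cardinal.lift_id, Cardinal.lift_id, Cardinal.lift_id'.{0}]
    refine Cardinal.add_le_of_le hK ?_ (Cardinal.mul_le_of_le hK ?_ ?_)
    · exact (Cardinal.lift_le_aleph0.2 Cardinal.mk_le_aleph0).trans hK
    · exact Cardinal.mk_le_of_injective (Sum.inr_injective.comp Sum.inl_injective)
    · exact le_rfl
  obtain ⟨c₁, hc₁⟩ := exists_injOn_closure (L := L₁) (K := K)
    (s := Set.range (Labelled.gen (T := T₁) lab)) (Cardinal.mk_range_le.trans hV)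
    ⟨⟨_, Sum.inr_injective.comp (Sum.inr_injective.comp Sum.inl_injective)⟩⟩
  obtain ⟨c₂, hc₂⟩ := exists_injOn_closure (L := L₂) (K := K)
    (s := Set.range (Labelled.gen (T := T₂) lab)) (Cardinal.mk_range_le.trans hV)
    ⟨⟨_, Sum.inr_injective.comp (Sum.inr_injective.comp Sum.inr_injective)⟩⟩
  let j₁ : Labelled T₁ V F → F × K := fun w => (w.2, c₁ w)
  let j₂ : Labelled T₂ V F → F × K := fun w => (w.2, c₂ w)
  let Φ : Set (F × K) →o Set (F × K) :=
    ⟨fun P => codes lab j₁ (codes lab j₂ P), (codes_mono lab j₁).comp (codes_mono lab j₂)⟩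
  obtain ⟨P₁, P₂, h₁, h₂⟩ : ∃ P₁ P₂, P₁ = codes lab j₁ P₂ ∧ P₂ = codes lab j₂ P₁ :=
    ⟨_, _, (Φ.map_lfp).symm, rfl⟩
  obtain ⟨κ₁, hinj₁, hrange₁, hX₁, hP₁, hl₁⟩ := exists_decoding (ρ := lab) (j := j₁)
    (fun w hw w' hw' h => hc₁ hw hw' (congrArg Prod.snd h)) (fun _ => rfl) h₁
  obtain ⟨κ₂, hinj₂, hrange₂, hX₂, hP₂, hl₂⟩ := exists_decoding (ρ := lab) (j := j₂)
    (fun w hw w' hw' h => hc₂ hw hw' (congrArg Prod.snd h)) (fun _ => rfl) h₂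
  let e : X ⊕ P₂ ⊕ P₁ ≃ X ⊕ P₁ ⊕ P₂ := Equiv.sumCongr (Equiv.refl X) (Equiv.sumComm P₂ P₁)
  obtain ⟨st₁, hM₁, hI₁, hh₁⟩ := Labelled.exists_structure hF₁ hinj₁ hrange₁
  obtain ⟨st₂, hM₂, hI₂, hh₂⟩ := Labelled.exists_structure hF₂ (κ := κ₂ ∘ e)
    (hinj₂.comp e.injective) ((e.surjective.range_comp κ₂).trans hrange₂)
  have hl : ∀ s, (κ₂ (e s)).2 = (κ₁ s).2 := by
    intro s
    rw [hl₁, hl₂]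
    rcases s with i | p | p <;> rfl
  refine ⟨X ⊕ P₂ ⊕ P₁, st₁, st₂, _, _, Sum.inl, fun s => (κ₁ s).2, hM₁, hM₂, hI₁, hI₂, ?_, ?_, ?_,
    Sum.inl_injective, hh₁, ?_, ?_⟩
  · refine Set.eq_univ_of_forall ?_
    rintro (i | p | p)
    · exact Or.inl ⟨_, (hX₁ i).symm⟩
    · exact Or.inl ⟨_, (hP₁ p).symm⟩
    · exact Or.inr ⟨_, (hP₂ p).symm⟩
  · rintro _ ⟨i, rfl⟩
    exact ⟨_, (hX₁ i).symm⟩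
  · rintro _ ⟨i, rfl⟩
    exact ⟨_, (hX₂ i).symm⟩
  · have : (fun s => ((κ₂ ∘ e) s).2) = fun s => (κ₁ s).2 := funext hl
    rwa [this] at hh₂
  · exact fun i => congrArg Prod.snd (hX₁ i)

end Model

/-! ### Triviality of the isotropy group -/

section Isotropy

theorem exists_isHom_freeModel {L : FirstOrder.Language.{u, v}} {T : EqTheory L} {γ : Type w}
    {M : Type w'} [L.Structure M] (hM : Models T M) (v : γ → M) :
    ∃ φ : FreeModel T γ → M, IsHom L φ ∧ ∀ c, φ (cls T (const c)) = v c := by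
  let φ : FreeModel T γ → M := Quotient.lift (eval v) fun _ _ h => ProvesClosed.sound hM h v
  have hφ : ∀ t, φ (cls T t) = eval v t := fun _ => rfl
  refine ⟨φ, fun m f a => ?_, fun c => (hφ _).trans (eval_const v c)⟩
  have ha : a = fun i => cls T (Quotient.out (a i)) := funext fun i => (cls_out _).symm
  rw [ha, funMap_cls, hφ, eval_app]
  rfl

variable {L₁ : FirstOrder.Language.{u₁, v₁}} {L₂ : FirstOrder.Language.{u₂, v₂}}
  {T₁ : EqTheory L₁} {T₂ : EqTheory L₂}

theorem models_reduct {L : FirstOrder.Language.{u, v}} {L' : FirstOrder.Language.{u₁, v₁}}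
    (φ : L →ᴸ L') {T : EqTheory L} {M : Type*} [L'.Structure M] (h : Models (T.map φ) M) :
    @Models L T M (φ.reduct M) :=
  let _ := φ.reduct M
  (models_map φ T).1 h

theorem models_disjUnion {M : Type*} [L₁.Structure M] [L₂.Structure M] (h₁ : Models T₁ M)
    (h₂ : Models T₂ M) : Models (T₁.disjUnion T₂) M := by
  rintro e (he | he)
  · exact (models_map (LHom.sumInl : L₁ →ᴸ L₁.sum L₂) T₁).2 h₁ e he
  · exact (models_map (LHom.sumInr : L₂ →ᴸ L₁.sum L₂) T₂).2 h₂ e he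

/-- An invertible closed term of the combined theory that commutes with all operations is provably
equal to `x`. -/
theorem cls_eq_of_commutesWith
    (hf₁ : ∃ (m : ℕ) (f : L₁.Functions m), ¬ IsConstant T₁ f ∧ ¬ IsProjection T₁ f)
    (hf₂ : ∃ (m : ℕ) (f : L₂.Functions m), ¬ IsConstant T₂ f ∧ ¬ IsProjection T₂ f)
    {n : ℕ} {t : ClosedTerm (L₁.sum L₂) (XY n)} (hinv : Invertible (T₁.disjUnion T₂) t)
    (hcomm : ∀ (m : ℕ) (f : (L₁.sum L₂).Functions m), CommutesWith (T₁.disjUnion T₂) t f) :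
    cls (T₁.disjUnion T₂) t = cls (T₁.disjUnion T₂) (xTerm (L₁.sum L₂) n) := by
  have : Nontrivial (TermModel T₁) := hf₁.elim fun _ h => h.elim fun _ h =>
    TermModel.nontrivial h.1
  have : Nontrivial (TermModel T₂) := hf₂.elim fun _ h => h.elim fun _ h =>
    TermModel.nontrivial h.1
  let F := FreeModel (T₁.disjUnion T₂) (ℕ ⊕ Fin n)
  -- The two reducts of the free model are kept local, so that its given structure is the only one
  -- used for the combined language.
  obtain ⟨S, st₁, st₂, A, B, x, ρ, hS₁, hS₂, hA, hB, hAB, hxA, hxB, hx, hρ₁, hρ₂, hρx⟩ :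
      ∃ (S : Type (max u₁ u₂)) (_ : L₁.Structure S) (_ : L₂.Structure S) (A B : Set S)
        (x : ℕ ⊕ Fin n → S) (ρ : S → F), Models T₁ S ∧ Models T₂ S ∧ Independent T₁ A ∧
        Independent T₂ B ∧ A ∪ B = Set.univ ∧ Set.range x ⊆ A ∧ Set.range x ⊆ B ∧
        Function.Injective x ∧
        (∀ (m : ℕ) (f : L₁.Functions m) (a : Fin m → S), ρ (funMap f a) =
          funMap (L := L₁.sum L₂) (Sum.inl f : (L₁.sum L₂).Functions m) fun i => ρ (a i)) ∧
        (∀ (m : ℕ) (f : L₂.Functions m) (a : Fin m → S), ρ (funMap f a) =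
          funMap (L := L₁.sum L₂) (Sum.inr f : (L₁.sum L₂).Functions m) fun i => ρ (a i)) ∧
        ∀ i, ρ (x i) = cls _ (const i) := by
    have h₁ := models_reduct (M := F) (LHom.sumInl : L₁ →ᴸ L₁.sum L₂) (T := T₁)
      fun e he => freeModel_models e (Or.inl he)
    have h₂ := models_reduct (M := F) (LHom.sumInr : L₂ →ᴸ L₁.sum L₂) (T := T₂)
      fun e he => freeModel_models e (Or.inr he)
    let _ : L₁.Structure F := (LHom.sumInl : L₁ →ᴸ L₁.sum L₂).reduct F
    let _ : L₂.Structure F := (LHom.sumInr : L₂ →ᴸ L₁.sum L₂).reduct F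
    exact exists_model h₁ h₂ fun i => cls _ (const i)
  have hS : Models (T₁.disjUnion T₂) S := models_disjUnion hS₁ hS₂
  have hρ : IsHom (L₁.sum L₂) ρ := by
    rintro m (f | f) a
    · exact hρ₁ m f a
    · exact hρ₂ m f a
  have hext : ∀ s : ℕ ⊕ Fin n → S, ∃ φ : S → S, IsHom L₁ φ ∧ IsHom L₂ φ ∧ ∀ i, φ (x i) = s i := by
    intro s
    obtain ⟨φ, hφ, hφs⟩ := exists_isHom_freeModel hS s
    have h := hφ.comp hρ
    exact ⟨φ ∘ ρ, fun m f => h m (Sum.inl f), fun m f => h m (Sum.inr f), fun i => by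
      rw [Function.comp_apply, hρx, hφs]⟩
  -- The operation on `S` defined by a closed term, with the parameters `y` interpreted in `S`.
  let val : ClosedTerm (L₁.sum L₂) (XY n) → S → S := fun r a =>
    eval (Sum.elim (fun _ => a) fun j => x (Sum.inr j)) r
  obtain ⟨t', -, ht'⟩ := hinv
  have hτ : Function.Injective (val t) := by
    refine Function.LeftInverse.injective (g := val t') fun a => ?_
    have h := ht'.sound hS (Sum.elim (fun _ => a) fun j => x (Sum.inr j))
    rw [eval_substX, xTerm, eval_const] at h
    exact h.symm
  have hτhom : IsHom (L₁.sum L₂) (val t) := by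
    intro m f a
    have h := (hcomm m f).sound hS (Sum.elim a fun j => x (Sum.inr j))
    simp only [eval_substX, eval_app, eval_const, Sum.elim_inl, Sum.elim_inr] at h
    exact h
  have hnat : ∀ φ : S → S, IsHom L₁ φ → IsHom L₂ φ →
      (∀ y, φ (x (Sum.inr y)) = x (Sum.inr y)) → ∀ a, φ (val t a) = val t (φ a) := by
    intro φ h₁ h₂ hy a
    have h : IsHom (L₁.sum L₂) φ := by
      rintro m (f | f) b
      · exact h₁ m f b
      · exact h₂ m f b
    refine (h.eval _ t).trans (congrArg (fun v => eval v t) (funext ?_))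
    rintro (_ | j)
    · rfl
    · exact hy j
  have hfix := natural_eq_self hA hB hAB hxA hxB hx hext hτ (fun m f => hτhom m (Sum.inl f))
    (fun m f => hτhom m (Sum.inr f)) hnat hf₁ hf₂ (exists_eval_mem_layer _ (by
      rintro (_ | j)
      · exact ⟨_, rfl⟩
      · exact ⟨_, rfl⟩) t)
  -- The equation found in `S` is carried to the free model on `x` and the `y`.
  obtain ⟨φ, hφ, hφg⟩ := exists_isHom_freeModel (T := T₁.disjUnion T₂) freeModel_models
    fun c : ℕ ⊕ Fin n => cls (T₁.disjUnion T₂) (const (Sum.map (fun _ => ()) id c : XY n))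
  have h := congrArg (φ ∘ ρ) hfix
  rw [(hφ.comp hρ).eval, Function.comp_apply, hρx, hφg] at h
  refine (eval_cls_const t).symm.trans (Eq.trans ?_ h)
  refine congrArg (fun v => eval v t) (funext ?_)
  rintro (_ | j)
  · exact ((congrArg φ (hρx (Sum.inl 0))).trans (hφg (Sum.inl 0))).symm
  · exact ((congrArg φ (hρx (Sum.inr j))).trans (hφg (Sum.inr j))).symm

end Isotropy

end EqLogic

theorem theorem1
    {L₁ : FirstOrder.Language.{u₁, v₁}} {L₂ : FirstOrder.Language.{u₂, v₂}}
    [L₁.IsAlgebraic] [L₂.IsAlgebraic]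
    (T₁ : EqLogic.EqTheory L₁) (T₂ : EqLogic.EqTheory L₂)
    (h₁ : ∃ (m : ℕ) (f : L₁.Functions m), 1 ≤ m ∧
      ¬ EqLogic.IsConstant T₁ f ∧ ¬ EqLogic.IsProjection T₁ f)
    (h₂ : ∃ (m : ℕ) (f : L₂.Functions m), 1 ≤ m ∧
      ¬ EqLogic.IsConstant T₂ f ∧ ¬ EqLogic.IsProjection T₂ f)
    (n : ℕ) :
    EqLogic.isotropyGroup (T₁.disjUnion T₂) n =
      {EqLogic.cls (T₁.disjUnion T₂) (EqLogic.xTerm (L₁.sum L₂) n)} := by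
  obtain ⟨m₁, f₁, -, hf₁⟩ := h₁
  obtain ⟨m₂, f₂, -, hf₂⟩ := h₂
  refine Set.Subset.antisymm ?_ ?_
  · rintro _ ⟨t, rfl, hinv, hcomm⟩
    exact EqLogic.cls_eq_of_commutesWith ⟨m₁, f₁, hf₁⟩ ⟨m₂, f₂, hf₂⟩ hinv hcomm
  · rintro _ rfl
    exact ⟨EqLogic.xTerm _ n, rfl,
      ⟨EqLogic.xTerm _ n, EqLogic.Proves.refl _, EqLogic.Proves.refl _⟩,
      fun m f => EqLogic.Proves.refl _⟩
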